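/- Let $K=\mathbb R$ or $\mathbb C$, let $(T,d)$ be a compact metric space with at least two points, $X\neq\{0\}$ a Hilbert space over $K$ with scalar product $(\cdot,\cdot)$ (linear in the first variable), and $(\Theta,\Sigma,W)$ a measure space. Write $\mathcal B_T,\mathcal B_X$ for the Borel $\sigma$-algebras. For each $\theta\in\Theta$ let $R_\theta:X\to X$ be linear and continuous and let $\omega_\theta:T\to T$ be Lipschitz with Lipschitz constant $r_\theta=\sup_{s\ne t} d(\omega_\theta(s),\omega_\theta(t))/d(s,t)$. Assume that $(t,\theta)\mapsto\omega_\theta(t)$ is $(\mathcal B_T\otimes\Sigma,\mathcal B_T)$-measurable, that $(x,\theta)\mapsto R_\theta(x)$ is $(\mathcal B_X\otimes\Sigma,\mathcal B_X)$-measurable, that for every $x\in X$ the map $\theta\mapsto R_\theta(x)$ is $W$-a.e. equal to a strongly measurable function (automatic if $X$ is separable), that $\theta\mapsto\|R_\theta\|$ is measurable, and that $$\int_\Theta\|R_\theta\|(1+r_\theta)\,dW(\theta)<\infty .$$ Let $C(T,X)$ be the space of continuous functions $T\to X$ with the norm $\|\cdot\|_\infty$, and let $H_C:C(T,X)\to C(T,X)$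 be the continuous linear operator $H_C(f)(t)=\int_\Theta R_\theta\big(f(\omega_\theta(t))\big)\,dW(\theta)$ (Bochner integral). Let $cabv(T,X)$ be the vector space of $\sigma$-additive measures $\mu:\mathcal B_T\to X$ of finite total variation. For $f\in C(T,X)$ and $\mu\in cabv(T,X)$ let $\int f\,d\mu\in K$ be the uniform sesquilinear integral: it equals $\sum_i(x_i,\mu(A_i))$ for a simple function $\sum_i 1_{A_i}x_i$ and is extended by uniform limits. Let $\Phi:cabv(T,X)\to C(T,X)'$, $\Phi(\mu)(f)=\int f\,d\mu$, let $H_C'(y)=y\circ H_C$ for $y\in C(T,X)'$, and let $\mathcal H=\Phi^{-1}\circ H_C'\circ\Phi$. The Monge–Kantorovich norm of $\mu\in cabv(T,X)$ is $$\|\mu\|_{MK}=\sup\Big\{\Big|\int f\,d\mu\Big| : f:T\to X \text{ Lipschitz},\ \|f\|_\infty+\|f\|_L\le 1\Big\},$$ where $\|f\|_L$ is the Lipschitz constant of $f$. Then $\mathcal H$ is well defined (for every $\nu\in cabv(T,X)$, $\mathcal H(\nu)$ is the unique $m\in cabv(T,X)$ with $\Phi(m)=H_C'(\Phi(\nu))$),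 the operator $\mathcal H:(cabv(T,X),\|\cdot\|_{MK})\to(cabv(T,X),\|\cdot\|_{MK})$ is linear and continuous, and its operator norm satisfies $$\|\mathcal H\|_{o,MK}\le\int_\Theta\|R_\theta\|(1+r_\theta)\,dW(\theta).$$ -/

import Mathlib

open MeasureTheory Set Filter Topology
open scoped ENNReal NNReal ComplexConjugate

set_option linter.unusedSectionVars false

namespace MKOp

/-! ### Lipschitz functions -/

/-- The Lipschitz constant `‖f‖_L = sup { d(f x, f y) / d(x, y) : x ≠ y }` of a function between
metric spaces (meaningful for Lipschitz functions, i.e. when the set is bounded above). -/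
noncomputable def lipConst {S Y : Type*} [MetricSpace S] [MetricSpace Y] (f : S → Y) : ℝ :=
  sSup {r : ℝ | ∃ x y : S, x ≠ y ∧ r = dist (f x) (f y) / dist x y}

/-- `f` is Lipschitz, i.e. `f ∈ Lip(S, Y)`. -/
def IsLip {S Y : Type*} [MetricSpace S] [MetricSpace Y] (f : S → Y) : Prop :=
  ∃ K : ℝ≥0, LipschitzWith K f

theorem lipConst_nonneg {S Y : Type*} [MetricSpace S] [MetricSpace Y] (f : S → Y) :
    0 ≤ lipConst f := by
  refine Real.sSup_nonneg ?_
  rintro r ⟨x, y, -, rfl⟩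
  positivity

theorem lipConst_le {S Y : Type*} [MetricSpace S] [MetricSpace Y] {f : S → Y} {K : ℝ≥0}
    (h : LipschitzWith K f) : lipConst f ≤ K := by
  refine Real.sSup_le ?_ K.2
  rintro r ⟨x, y, hxy, rfl⟩
  rw [div_le_iff₀ (dist_pos.2 hxy)]
  exact h.dist_le_mul x y

section Integral

variable (𝕜 : Type*) [RCLike 𝕜]
variable {T : Type*} [MetricSpace T] [CompactSpace T] [MeasurableSpace T] [BorelSpace T]
variable {X : Type*} [NormedAddCommGroup X] [InnerProductSpace 𝕜 X]
  [NormedSpace ℝ X] [IsScalarTower ℝ 𝕜 X]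

/-! ### Vector measures of bounded variation and the sesquilinear integral -/

variable (T X) in
/-- `cabv(T, X)`: the `σ`-additive `X`-valued measures on the Borel sets of `T` whose total
variation `|μ|(T)` is finite. -/
def Cabv : Submodule 𝕜 (VectorMeasure T X) where
  carrier := {μ | μ.variation univ < ∞}
  zero_mem' := by simp
  add_mem' {μ ν} hμ hν :=
    (VectorMeasure.variation_add_le (μ := μ) (ν := ν) univ).trans_lt
      (by simpa using ⟨hμ, hν⟩)
  smul_mem' c μ hμ := by
    simp only [mem_ofPred_eq, VectorMeasure.variation_smul] at hμ ⊢
    simpa using ENNReal.mul_lt_top ENNReal.coe_lt_top hμ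

instance (μ : Cabv 𝕜 T X) : IsFiniteMeasure μ.1.variation := ⟨μ.2⟩

variable (X) in
/-- The scalar product `(x, y)`, linear in `x` and antilinear in `y`, as a real bilinear map.
(Mathlib's `inner 𝕜 x y` is antilinear in `x`.) -/
noncomputable def pairing : X →L[ℝ] X →L[ℝ] 𝕜 :=
  LinearMap.mkContinuous₂
    (LinearMap.mk₂ ℝ (fun x y : X => (inner 𝕜 y x : 𝕜))
      (fun x x' y => inner_add_right y x x')
      (fun c x y => by
        rw [← algebraMap_smul 𝕜 c x, inner_smul_right, Algebra.smul_def])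
      (fun x y y' => inner_add_left y y' x)
      (fun c x y => by
        rw [← algebraMap_smul 𝕜 c y, inner_smul_left, Algebra.smul_def]
        simp))
    1 (fun x y => by
      simpa [mul_comm] using norm_inner_le_norm (𝕜 := 𝕜) y x)

@[simp] theorem pairing_apply (x y : X) : pairing 𝕜 X x y = inner 𝕜 y x := rfl

theorem norm_pairing_le : ‖pairing 𝕜 X‖ ≤ 1 :=
  LinearMap.mkContinuous₂_norm_le _ zero_le_one _

variable {𝕜}

/-- The sesquilinear integral `∫ f dμ` of a function `f : T → X` with respect to `μ ∈ cabv(T, X)`.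
It is the integral of Mathlib for the pairing `(x, y)`; the two theorems `sint_simple` and
`tendsto_sint` below show that it is the uniform integral: it is `∑ (xᵢ, μ(Aᵢ))` on the simple
function `∑ 1_{Aᵢ} xᵢ`, and is the limit of the integrals of `fₙ` if the simple functions `fₙ`
converge uniformly to `f`. -/
noncomputable def sint (f : T → X) (μ : Cabv 𝕜 T X) : 𝕜 :=
  VectorMeasure.integral μ.1 f (pairing 𝕜 X)

theorem sint_indicator (μ : Cabv 𝕜 T X) {A : Set T} (hA : MeasurableSet A) (x : X) :
    sint (A.indicator fun _ => x) μ = inner 𝕜 (μ.1 A) x := by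
  rw [sint, VectorMeasure.integral_indicator hA, VectorMeasure.integral_const]
  simp [VectorMeasure.restrict_apply, hA]

theorem sint_simple (μ : Cabv 𝕜 T X) {ι : Type*} (s : Finset ι) (A : ι → Set T)
    (hA : ∀ i ∈ s, MeasurableSet (A i)) (x : ι → X) :
    sint (fun t => ∑ i ∈ s, (A i).indicator (fun _ => x i) t) μ
      = ∑ i ∈ s, inner 𝕜 (μ.1 (A i)) (x i) := by
  rw [sint, VectorMeasure.integral_finsetSum]
  · exact Finset.sum_congr rfl fun i hi => sint_indicator μ (hA i hi) (x i)
  · intro i hi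
    exact (integrable_const (x i)).indicator (hA i hi)

theorem simpleFunc_eq_sum (φ : SimpleFunc T X) :
    (φ : T → X) = fun t => ∑ x ∈ φ.range, (φ ⁻¹' {x}).indicator (fun _ => x) t := by
  classical
  funext t
  rw [Finset.sum_eq_single (φ t)]
  · simp
  · intro b _ hb
    rw [indicator_of_notMem]
    simpa using hb.symm
  · intro h
    exact absurd (φ.mem_range_self t) h

theorem norm_sint_le (μ : Cabv 𝕜 T X) {f : T → X} {C : ℝ} (hC : 0 ≤ C) (h : ∀ t, ‖f t‖ ≤ C) :
    ‖sint f μ‖ ≤ C * μ.1.variation.real univ := by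
  refine (VectorMeasure.norm_integral_le_of_norm_le_const (Eventually.of_forall h)).trans ?_
  have := norm_pairing_le (X := X) 𝕜
  have h2 : 0 ≤ μ.1.variation.real univ := measureReal_nonneg
  calc C * ‖pairing 𝕜 X‖ * μ.1.variation.real univ ≤ C * 1 * μ.1.variation.real univ := by gcongr
    _ = _ := by ring

theorem tendsto_sint (μ : Cabv 𝕜 T X) {f : T → X} {φ : ℕ → SimpleFunc T X}
    (h : TendstoUniformly (fun n => (φ n : T → X)) f atTop) :
    Tendsto (fun n => sint (φ n) μ) atTop (𝓝 (sint f μ)) := by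
  have hf : AEStronglyMeasurable f μ.1.variation :=
    aestronglyMeasurable_of_tendsto_ae atTop (fun n => (φ n).aestronglyMeasurable)
      (Eventually.of_forall fun t => h.tendsto_at t)
  refine VectorMeasure.tendsto_integral_of_L1 f hf
    (Eventually.of_forall fun n => (φ n).integrable_of_isFiniteMeasure) ?_
  rw [ENNReal.tendsto_nhds_zero]
  intro ε hε
  obtain ⟨δ, hδ, hδε⟩ : ∃ δ : ℝ, 0 < δ ∧ ENNReal.ofReal δ * μ.1.variation univ ≤ ε := by
    rcases eq_or_ne ε ∞ with rfl | hε'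
    · exact ⟨1, one_pos, le_top⟩
    · have hv : μ.1.variation univ ≠ ∞ := μ.2.ne
      have he : 0 < ε.toReal := ENNReal.toReal_pos hε.ne' hε'
      have hv0 : 0 ≤ (μ.1.variation univ).toReal := ENNReal.toReal_nonneg
      refine ⟨ε.toReal / ((μ.1.variation univ).toReal + 1), by positivity, ?_⟩
      rw [← ENNReal.ofReal_toReal hv, ← ENNReal.ofReal_mul (by positivity)]
      conv_rhs => rw [← ENNReal.ofReal_toReal hε']
      refine ENNReal.ofReal_le_ofReal ?_
      rw [ENNReal.toReal_ofReal hv0, div_mul_eq_mul_div, div_le_iff₀ (by positivity)]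
      nlinarith
  filter_upwards [Metric.tendstoUniformly_iff.1 h δ hδ] with n hn
  calc ∫⁻ t, ‖φ n t - f t‖ₑ ∂μ.1.variation ≤ ∫⁻ _, ENNReal.ofReal δ ∂μ.1.variation := by
        refine lintegral_mono fun t => ?_
        rw [← ofReal_norm]
        refine ENNReal.ofReal_le_ofReal ?_
        rw [← dist_eq_norm, dist_comm]
        exact (hn t).le
    _ ≤ ε := by simpa using hδε

theorem integrable_continuous (μ : Cabv 𝕜 T X) (f : C(T, X)) : μ.1.Integrable f :=
  f.continuous.integrable_of_hasCompactSupport (HasCompactSupport.of_compactSpace _)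

theorem sint_add (μ : Cabv 𝕜 T X) (f g : C(T, X)) :
    sint (fun t => f t + g t) μ = sint f μ + sint g μ :=
  VectorMeasure.integral_fun_add (integrable_continuous μ f) (integrable_continuous μ g)

theorem sint_smul (μ : Cabv 𝕜 T X) (c : 𝕜) (f : T → X) :
    sint (c • f) μ = c * sint f μ := by
  rw [sint, sint, VectorMeasure.integral_eq_setToFun, VectorMeasure.integral_eq_setToFun,
    setToFun_smul, smul_eq_mul]
  intro c s x
  change pairing 𝕜 X (c • x) (μ.1 s) = c • pairing 𝕜 X x (μ.1 s)
  simp [inner_smul_right]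

theorem sint_add_measure (μ ν : Cabv 𝕜 T X) (f : C(T, X)) :
    sint f (μ + ν) = sint f μ + sint f ν :=
  VectorMeasure.integral_add_vectorMeasure (integrable_continuous μ f) (integrable_continuous ν f)

theorem sint_smul_measure (μ : Cabv 𝕜 T X) (c : 𝕜) (f : C(T, X)) :
    sint f (c • μ) = conj c * sint f μ := by
  have hf : StronglyMeasurable f := f.continuous.stronglyMeasurable
  let φ : ℕ → SimpleFunc T X := fun n => hf.approxBounded ‖f‖ n
  have hb : ∀ n t, ‖φ n t‖ ≤ ‖f‖ := fun n t =>
    hf.norm_approxBounded_le (norm_nonneg f) n t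
  have hlim : ∀ ν : Cabv 𝕜 T X, Tendsto (fun n => sint (φ n) ν) atTop (𝓝 (sint f ν)) := fun ν =>
    VectorMeasure.tendsto_integral_filter_of_norm_le_const
      (Eventually.of_forall fun n => (φ n).aestronglyMeasurable)
      ⟨‖f‖, Eventually.of_forall fun n => Eventually.of_forall (hb n)⟩
      (Eventually.of_forall fun t => hf.tendsto_approxBounded_of_norm_le (f.norm_coe_le_norm t))
  refine tendsto_nhds_unique (hlim (c • μ)) ?_
  have h : ∀ n, sint (φ n) (c • μ) = conj c * sint (φ n) μ := fun n => by
    rw [simpleFunc_eq_sum (φ n),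
      sint_simple _ _ _ (fun x _ => (φ n).measurableSet_fiber x),
      sint_simple _ _ _ (fun x _ => (φ n).measurableSet_fiber x), Finset.mul_sum]
    refine Finset.sum_congr rfl fun x _ => ?_
    change inner 𝕜 (c • μ.1 _) x = _
    rw [inner_smul_left]
  simp_rw [h]
  exact (hlim μ).const_mul _

variable (𝕜 T X) in
/-- The antilinear map `Φ : cabv(T, X) → C(T, X)'`, `Φ(μ)(f) = ∫ f dμ`. -/
noncomputable def Phi : Cabv 𝕜 T X →ₛₗ[starRingEnd 𝕜] StrongDual 𝕜 C(T, X) where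
  toFun μ := LinearMap.mkContinuous
    { toFun := fun f => sint f μ
      map_add' := fun f g => sint_add μ f g
      map_smul' := fun c f => sint_smul μ c f }
    (μ.1.variation.real univ)
    (fun f => (norm_sint_le μ (norm_nonneg f) f.norm_coe_le_norm).trans_eq (mul_comm _ _))
  map_add' μ ν := by
    ext f
    exact sint_add_measure μ ν f
  map_smul' c μ := by
    ext f
    exact sint_smul_measure μ c f

@[simp] theorem Phi_apply (μ : Cabv 𝕜 T X) (f : C(T, X)) : Phi 𝕜 T X μ f = sint f μ := rfl

/-! ### The Monge–Kantorovich norm -/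

variable (T X) in
/-- The unit ball `BL₁(X)` of the Lipschitz functions `f : T → X` for the norm
`‖f‖_BL = ‖f‖_∞ + ‖f‖_L`. -/
def BL1 : Set C(T, X) := {f | IsLip f ∧ ‖f‖ + lipConst f ≤ 1}

/-- The Monge–Kantorovich norm `‖μ‖_MK = sup { |∫ f dμ| : f ∈ BL₁(X) }`. -/
noncomputable def mkNorm (μ : Cabv 𝕜 T X) : ℝ :=
  sSup {r : ℝ | ∃ f ∈ BL1 T X, r = ‖sint f μ‖}

theorem zero_mem_BL1 : (0 : C(T, X)) ∈ BL1 T X := by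
  have h : LipschitzWith 0 (0 : C(T, X)) := LipschitzWith.const 0
  refine ⟨⟨0, h⟩, ?_⟩
  have h1 : lipConst (0 : C(T, X)) ≤ 0 := by simpa using lipConst_le h
  rw [norm_zero]
  linarith

theorem mkNorm_bddAbove (μ : Cabv 𝕜 T X) :
    BddAbove {r : ℝ | ∃ f ∈ BL1 T X, r = ‖sint f μ‖} := by
  refine ⟨μ.1.variation.real univ, ?_⟩
  rintro r ⟨f, hf, rfl⟩
  have h1 : ‖f‖ ≤ 1 := by linarith [hf.2, lipConst_nonneg f]
  simpa using norm_sint_le μ zero_le_one fun t => (f.norm_coe_le_norm t).trans h1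

theorem le_mkNorm (μ : Cabv 𝕜 T X) {f : C(T, X)} (hf : f ∈ BL1 T X) : ‖sint f μ‖ ≤ mkNorm μ :=
  le_csSup (mkNorm_bddAbove μ) ⟨f, hf, rfl⟩

theorem mkNorm_le (μ : Cabv 𝕜 T X) {C : ℝ} (h : ∀ f ∈ BL1 T X, ‖sint f μ‖ ≤ C) :
    mkNorm μ ≤ C := by
  refine csSup_le ⟨_, 0, zero_mem_BL1, rfl⟩ ?_
  rintro r ⟨f, hf, rfl⟩
  exact h f hf

theorem mkNorm_nonneg (μ : Cabv 𝕜 T X) : 0 ≤ mkNorm μ :=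
  (norm_nonneg _).trans (le_mkNorm μ zero_mem_BL1)

theorem sint_eq_zero_of_mkNorm {μ : Cabv 𝕜 T X} (h : mkNorm μ = 0) (f : C(T, X)) (hf : IsLip f) :
    sint f μ = 0 := by
  obtain ⟨K, hK⟩ := hf
  have hpos : 0 < ‖f‖ + K + 1 := by positivity
  set a : ℝ := (‖f‖ + K + 1)⁻¹ with ha
  have ha0 : 0 < a := inv_pos.2 hpos
  have hna : ‖(a : 𝕜)‖ = a := by rw [RCLike.norm_ofReal, abs_of_pos ha0]
  have hL : LipschitzWith (⟨a, ha0.le⟩ * K) ((a : 𝕜) • f) := by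
    refine LipschitzWith.of_dist_le_mul fun x y => ?_
    simp only [ContinuousMap.smul_apply, dist_smul₀, hna]
    have := hK.dist_le_mul x y
    calc a * dist (f x) (f y) ≤ a * (K * dist x y) := by gcongr
      _ = _ := by rw [← mul_assoc]; rfl
  have hmem : (a : 𝕜) • f ∈ BL1 T X := by
    refine ⟨⟨_, hL⟩, ?_⟩
    have h1 : lipConst ((a : 𝕜) • f : C(T, X)) ≤ a * K := lipConst_le hL
    have h2 : ‖(a : 𝕜) • f‖ = a * ‖f‖ := by rw [norm_smul, hna]
    have h3 : a * (‖f‖ + K + 1) = 1 := inv_mul_cancel₀ hpos.ne'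
    nlinarith
  have h0 : ‖sint ((a : 𝕜) • f : C(T, X)) μ‖ ≤ 0 := h ▸ le_mkNorm μ hmem
  have h1 : sint ((a : 𝕜) • f : C(T, X)) μ = (a : 𝕜) * sint f μ := sint_smul μ _ f
  rw [h1, norm_le_zero_iff, mul_eq_zero] at h0
  exact h0.resolve_left (by simpa using ha0.ne')

theorem eq_zero_of_sint_lip {μ : Cabv 𝕜 T X}
    (h : ∀ f : C(T, X), IsLip f → sint f μ = 0) : μ = 0 := by
  have key : ∀ F : Set T, IsClosed F → μ.1 F = 0 := by
    intro F hF
    refine ext_inner_right 𝕜 fun x => ?_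
    rw [inner_zero_left, ← sint_indicator μ hF.measurableSet x]
    have hδ : ∀ n : ℕ, 0 < (1 : ℝ) / (n + 1) := fun n => by positivity
    let g : ℕ → T → ℝ≥0 := fun n => thickenedIndicator (hδ n) F
    have hgL : ∀ n, IsLip (g n) := fun n => ⟨_, lipschitzWith_thickenedIndicator (hδ n) F⟩
    have hg1 : ∀ n t, g n t ≤ 1 := fun n t => thickenedIndicator_le_one (hδ n) F t
    have hgc : ∀ n, Continuous (g n) := fun n => (thickenedIndicator (hδ n) F).continuous
    let f : ℕ → C(T, X) := fun n =>
      ⟨fun t => ((g n t : ℝ) : 𝕜) • x, by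
        have := hgc n
        fun_prop⟩
    have hfL : ∀ n, IsLip (f n) := fun n => by
      obtain ⟨K, hK⟩ := hgL n
      refine ⟨K * ‖x‖₊, LipschitzWith.of_dist_le_mul fun s t => ?_⟩
      have h1 := hK.dist_le_mul s t
      change dist (((g n s : ℝ) : 𝕜) • x) (((g n t : ℝ) : 𝕜) • x) ≤ _
      rw [dist_eq_norm, ← sub_smul, norm_smul, ← RCLike.ofReal_sub, RCLike.norm_ofReal,
        ← Real.dist_eq]
      change dist (g n s) (g n t) * ‖x‖ ≤ K * ‖x‖ * dist s t
      calc dist (g n s) (g n t) * ‖x‖ ≤ (K * dist s t) * ‖x‖ := by gcongr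
        _ = K * ‖x‖ * dist s t := by ring
    have hlim : Tendsto (fun n => sint (f n) μ) atTop (𝓝 (sint (F.indicator fun _ => x) μ)) := by
      refine VectorMeasure.tendsto_integral_filter_of_norm_le_const
        (Eventually.of_forall fun n => (f n).continuous.aestronglyMeasurable)
        ⟨‖x‖, Eventually.of_forall fun n => Eventually.of_forall fun t => ?_⟩
        (Eventually.of_forall fun t => ?_)
      · change ‖((g n t : ℝ) : 𝕜) • x‖ ≤ _
        rw [norm_smul, RCLike.norm_ofReal, abs_of_nonneg (NNReal.coe_nonneg _)]
        exact mul_le_of_le_one_left (norm_nonneg x) (by exact_mod_cast hg1 n t)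
      · have h2 := tendsto_pi_nhds.1 (thickenedIndicator_tendsto_indicator_closure hδ
          tendsto_one_div_add_atTop_nhds_zero_nat F) t
        rw [hF.closure_eq] at h2
        have h3 : Tendsto (fun n => ((g n t : ℝ) : 𝕜) • x) atTop
            (𝓝 ((((F.indicator (fun _ => (1 : ℝ≥0)) t : ℝ≥0) : ℝ) : 𝕜) • x)) := by
          have hc : Continuous fun r : ℝ≥0 => ((r : ℝ) : 𝕜) • x := by fun_prop
          exact (hc.tendsto _).comp h2
        have h4 : ((((F.indicator (fun _ => (1 : ℝ≥0)) t : ℝ≥0) : ℝ) : 𝕜) • x)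
            = F.indicator (fun _ => x) t := by
          by_cases ht : t ∈ F <;> simp [ht]
        rwa [h4] at h3
    simp_rw [fun n => h (f n) (hfL n)] at hlim
    exact tendsto_nhds_unique hlim tendsto_const_nhds
  refine Subtype.ext (VectorMeasure.ext_of_generateFrom {s | IsClosed s} (fun s hs => ?_) ?_
    isPiSystem_isClosed ?_)
  · simpa using key s hs
  · rw [BorelSpace.measurable_eq (α := T), borel_eq_generateFrom_isClosed]
  · simpa using key univ isClosed_univ

/-- `cabv(T, X)` is normed by the Monge–Kantorovich norm. -/
noncomputable instance instNormCabv : Norm (Cabv 𝕜 T X) := ⟨mkNorm⟩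

theorem norm_def (μ : Cabv 𝕜 T X) : ‖μ‖ = mkNorm μ := rfl

theorem cabv_core : NormedSpace.Core 𝕜 (Cabv 𝕜 T X) where
  norm_nonneg μ := mkNorm_nonneg μ
  norm_smul c μ := by
    have hle : ∀ (c : 𝕜) (μ : Cabv 𝕜 T X), mkNorm (c • μ) ≤ ‖c‖ * mkNorm μ := fun c μ =>
      mkNorm_le _ fun f hf => by
        rw [sint_smul_measure, norm_mul, RCLike.norm_conj]
        exact mul_le_mul_of_nonneg_left (le_mkNorm μ hf) (norm_nonneg c)
    refine le_antisymm (hle c μ) ?_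
    rcases eq_or_ne c 0 with rfl | hc
    · rw [norm_zero, zero_mul]
      exact mkNorm_nonneg _
    · have h := hle c⁻¹ (c • μ)
      rw [inv_smul_smul₀ hc, norm_inv] at h
      have hc' : 0 < ‖c‖ := norm_pos_iff.2 hc
      calc ‖c‖ * mkNorm μ ≤ ‖c‖ * (‖c‖⁻¹ * mkNorm (c • μ)) := by gcongr
        _ = mkNorm (c • μ) := by field_simp
  norm_triangle μ ν := mkNorm_le _ fun f hf => by
    rw [sint_add_measure]
    exact (norm_add_le _ _).trans (add_le_add (le_mkNorm μ hf) (le_mkNorm ν hf))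
  norm_eq_zero_iff μ := by
    refine ⟨fun h => eq_zero_of_sint_lip fun f hf => sint_eq_zero_of_mkNorm h f hf, ?_⟩
    rintro rfl
    refine le_antisymm (mkNorm_le _ fun f _ => ?_) (mkNorm_nonneg _)
    rw [← Phi_apply, map_zero]
    simp

noncomputable instance instNormedAddCommGroupCabv : NormedAddCommGroup (Cabv 𝕜 T X) :=
  NormedAddCommGroup.ofCore cabv_core

noncomputable instance instNormedSpaceCabv : NormedSpace 𝕜 (Cabv 𝕜 T X) :=
  NormedSpace.ofCore cabv_core

end Integral

/-! ### The operators -/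

section Operators

variable {𝕜 : Type*} [RCLike 𝕜]
variable {T : Type*} [MetricSpace T] [CompactSpace T] [MeasurableSpace T] [BorelSpace T]
variable {X : Type*} [NormedAddCommGroup X] [InnerProductSpace 𝕜 X]
  [NormedSpace ℝ X] [IsScalarTower ℝ 𝕜 X] [MeasurableSpace X] [BorelSpace X]
variable {Θ : Type*} [MeasurableSpace Θ]

/-- The standing hypotheses on the index space `(Θ, Σ, W)` and the families `R_θ ∈ L(X)` and
`ω_θ : T → T`. -/
structure Admissible (W : Measure Θ) (R : Θ → X →L[𝕜] X) (ω : Θ → T → T) : Prop where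
  /-- `(t, θ) ↦ ω_θ(t)` is measurable for the product `σ`-algebra. -/
  measurable_omega : Measurable fun p : T × Θ => ω p.2 p.1
  /-- `(x, θ) ↦ R_θ(x)` is measurable for the product `σ`-algebra. -/
  measurable_R : Measurable fun p : X × Θ => R p.2 p.1
  /-- Every `θ ↦ R_θ(x)` is measurable in the sense of the Bochner integral. If `X` is separable,
  this follows from `measurable_R`. -/
  aestronglyMeasurable_R : ∀ x : X, AEStronglyMeasurable (fun θ => R θ x) W
  /-- Every `ω_θ` is Lipschitz. -/
  isLip_omega : ∀ θ, IsLip (ω θ)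
  /-- `θ ↦ ‖R_θ‖` is measurable. -/
  measurable_norm : Measurable fun θ => ‖R θ‖
  /-- `∫ ‖R_θ‖ (1 + r_θ) dW(θ) < ∞`, where `r_θ = ‖ω_θ‖_L`. -/
  lintegral_lt_top : ∫⁻ θ, ENNReal.ofReal (‖R θ‖ * (1 + lipConst (ω θ))) ∂W < ∞

variable {W : Measure Θ} {R : Θ → X →L[𝕜] X} {ω : Θ → T → T}

namespace Admissible

theorem integrable_norm (h : Admissible W R ω) : Integrable (fun θ => ‖R θ‖) W := by
  refine ⟨h.measurable_norm.aestronglyMeasurable, ?_⟩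
  refine lt_of_le_of_lt (lintegral_mono fun θ => ?_) h.lintegral_lt_top
  rw [enorm_norm, ← ofReal_norm]
  refine ENNReal.ofReal_le_ofReal ?_
  nlinarith [norm_nonneg (R θ), lipConst_nonneg (ω θ)]

theorem aestronglyMeasurable_comp (h : Admissible W R ω) {g : Θ → X} (hg : StronglyMeasurable g) :
    AEStronglyMeasurable (fun θ => R θ (g θ)) W := by
  have hs : ∀ φ : SimpleFunc Θ X, AEStronglyMeasurable (fun θ => R θ (φ θ)) W := by
    intro φ
    induction φ using SimpleFunc.induction with
    | @const c s hs =>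
      convert (h.aestronglyMeasurable_R c).indicator hs using 1
      funext θ
      by_cases hθ : θ ∈ s <;> simp [hθ]
    | @add f g _ hf hg =>
      simp only [SimpleFunc.coe_add, Pi.add_apply, map_add]
      exact hf.add hg
  exact aestronglyMeasurable_of_tendsto_ae atTop (fun n => hs (hg.approx n))
    (Eventually.of_forall fun θ => ((R θ).continuous.tendsto _).comp (hg.tendsto_approx θ))

theorem norm_apply_le (f : C(T, X)) (t : T) (θ : Θ) : ‖R θ (f (ω θ t))‖ ≤ ‖R θ‖ * ‖f‖ :=
  (R θ).le_opNorm_of_le (f.norm_coe_le_norm _)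

theorem aestronglyMeasurable_apply (h : Admissible W R ω) (f : C(T, X)) (t : T) :
    AEStronglyMeasurable (fun θ => R θ (f (ω θ t))) W := by
  have hm : Measurable fun θ => ω θ t := h.measurable_omega.comp measurable_prodMk_left
  exact h.aestronglyMeasurable_comp (f.continuous.comp_stronglyMeasurable hm.stronglyMeasurable)

/-- For every `f ∈ C(T, X)` and `t ∈ T`, `θ ↦ (R_θ ∘ f ∘ ω_θ)(t)` is Bochner integrable. -/
theorem integrable_apply (h : Admissible W R ω) (f : C(T, X)) (t : T) :
    Integrable (fun θ => R θ (f (ω θ t))) W :=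
  (h.integrable_norm.mul_const ‖f‖).mono' (h.aestronglyMeasurable_apply f t)
    (Eventually.of_forall fun θ => norm_apply_le f t θ)

end Admissible

/-- The operator `H_C : C(T, X) → C(T, X)`, `H_C(f)(t) = ∫ (R_θ ∘ f ∘ ω_θ)(t) dW(θ)`, a Bochner
integral. -/
noncomputable def HC (h : Admissible W R ω) : C(T, X) →L[𝕜] C(T, X) :=
  LinearMap.mkContinuous
    { toFun := fun f =>
        { toFun := fun t => ∫ θ, R θ (f (ω θ t)) ∂W
          continuous_toFun := continuous_of_dominated
            (fun t => h.aestronglyMeasurable_apply f t)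
            (fun t => Eventually.of_forall fun θ => Admissible.norm_apply_le f t θ)
            (h.integrable_norm.mul_const ‖f‖)
            (Eventually.of_forall fun θ => by
              obtain ⟨K, hK⟩ := h.isLip_omega θ
              exact (R θ).continuous.comp (f.continuous.comp hK.continuous)) }
      map_add' := fun f g => by
        ext t
        simpa using integral_add (h.integrable_apply f t) (h.integrable_apply g t)
      map_smul' := fun c f => by
        ext t
        simpa using integral_smul c (fun θ => R θ (f (ω θ t))) }
    (∫ θ, ‖R θ‖ ∂W)
    (fun f => by
      have h0 : 0 ≤ ∫ θ, ‖R θ‖ ∂W := integral_nonneg fun θ => norm_nonneg _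
      refine (ContinuousMap.norm_le _ (by positivity)).2 fun t => ?_
      rw [← integral_mul_const]
      exact norm_integral_le_of_norm_le (h.integrable_norm.mul_const ‖f‖)
        (Eventually.of_forall fun θ => Admissible.norm_apply_le f t θ))

theorem HC_apply (h : Admissible W R ω) (f : C(T, X)) (t : T) :
    HC h f t = ∫ θ, R θ (f (ω θ t)) ∂W := rfl

/-- The adjoint `H_C' : C(T, X)' → C(T, X)'`, `H_C'(y) = y ∘ H_C`. -/
noncomputable def HCadj (h : Admissible W R ω) (y : StrongDual 𝕜 C(T, X)) :
    StrongDual 𝕜 C(T, X) :=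
  y.comp (HC h)

/-- The operator `ℋ = Φ⁻¹ ∘ H_C' ∘ Φ` on `cabv(T, X)`. (`Φ⁻¹` is the inverse of `Φ` on its range.) -/
noncomputable def opH (h : Admissible W R ω) (ν : Cabv 𝕜 T X) : Cabv 𝕜 T X :=
  Function.invFun (Phi 𝕜 T X) (HCadj h (Phi 𝕜 T X ν))

end Operators

end MKOp

open MKOp

/-!
The operator `ℋ` is the adjoint of `H_C` transported to measures by `Φ`, so
`∫ f dℋ(ν) = ∫ H_C(f) dν`. Two things have to be shown.

*`ℋ` is well defined.* `Φ` is injective because Lipschitz functions separate measures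
(`Phi_injective`). Surjectivity of `Φ` is not needed, only that `H_C'(Φ(ν))` lies in its range.
The functional `f ↦ ∫ H_C(f) dν` satisfies
`|∫ H_C(f) dν| ≤ ∫∫ ‖R_θ‖ ‖f(ω_θ(t))‖ dW(θ) d|ν|(t) = ∫ ‖f‖ dλ`, where the finite positive
measure `λ` is the image of `|ν| ⊗ ‖R_θ‖ dW(θ)` under `(t, θ) ↦ ω_θ(t)`. A functional on `C(T, X)`
dominated in this way extends to the Hilbert space `L²(λ; X)`, where it is the scalar product
with some `g`; the measure `g λ` has finite variation and represents the functional
(`exists_Phi_eq_of_enorm_le`, `Admissible.exists_Phi_eq_HCadj`). Since `Φ` is antilinear and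
injective, `ℋ` is linear.

*The bound.* For `f ∈ BL₁(X)`, both `‖f‖_∞` and `‖f‖_L` are at most `1`, so that
`‖H_C(f)‖_∞ + ‖H_C(f)‖_L ≤ ∫ ‖R_θ‖ dW + ∫ ‖R_θ‖ r_θ dW` (`Admissible.norm_HC_add_lipConst_le`);
by homogeneity `|∫ H_C(f) dν|` is at most this constant times `‖ν‖_MK`
(`norm_sint_le_mul_mkNorm`). The Bochner integrals are meaningful because `θ ↦ r_θ` is measurable
(`Admissible.measurable_lipConst`).
-/

namespace MKOp

/-! ### Lipschitz constants -/

section Lipschitz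

variable {S Y : Type*} [MetricSpace S] [MetricSpace Y] {f : S → Y}

theorem IsLip.dist_le_lipConst_mul (hf : IsLip f) (x y : S) :
    dist (f x) (f y) ≤ lipConst f * dist x y := by
  obtain ⟨K, hK⟩ := hf
  rcases eq_or_ne x y with rfl | hxy
  · simp
  rw [← div_le_iff₀ (dist_pos.2 hxy)]
  refine le_csSup ⟨K, ?_⟩ ⟨x, y, hxy, rfl⟩
  rintro r ⟨x, y, hxy, rfl⟩
  rw [div_le_iff₀ (dist_pos.2 hxy)]
  exact hK.dist_le_mul x y

theorem lipConst_le_of_dist_le {C : ℝ} (hC : 0 ≤ C)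
    (h : ∀ x y, dist (f x) (f y) ≤ C * dist x y) : lipConst f ≤ C :=
  lipConst_le (K := ⟨C, hC⟩) (LipschitzWith.of_dist_le_mul h)

/-- The Lipschitz constant is the supremum of the difference quotients over a dense set. The
pairs with `x = y` contribute `0`, by the convention for division by zero. -/
theorem IsLip.lipConst_eq_iSup (hf : IsLip f) {ι : Type*} {u : ι → S} (hu : DenseRange u) :
    lipConst f = ⨆ p : ι × ι, dist (f (u p.1)) (f (u p.2)) / dist (u p.1) (u p.2) := by
  have hle : ∀ p : ι × ι, dist (f (u p.1)) (f (u p.2)) / dist (u p.1) (u p.2) ≤ lipConst f :=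
    fun p => div_le_of_le_mul₀ dist_nonneg (lipConst_nonneg f) (hf.dist_le_lipConst_mul _ _)
  have hcont : Continuous f := by
    obtain ⟨K, hK⟩ := hf
    exact hK.continuous
  refine le_antisymm (lipConst_le_of_dist_le (Real.iSup_nonneg fun p => by positivity) ?_)
    (Real.iSup_le hle (lipConst_nonneg f))
  refine fun x y => hu.induction_on₂ (p := fun x y => dist (f x) (f y) ≤ _ * dist x y)
    (isClosed_le (by fun_prop) (by fun_prop)) (fun i j => ?_) x y
  rcases eq_or_ne (u i) (u j) with hij | hij
  · simp [hij]
  rw [← div_le_iff₀ (dist_pos.2 hij)]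
  exact le_ciSup (f := fun p : ι × ι => dist (f (u p.1)) (f (u p.2)) / dist (u p.1) (u p.2))
    ⟨lipConst f, by rintro _ ⟨p, rfl⟩; exact hle p⟩ (i, j)

end Lipschitz

/-! ### The sesquilinear integral and the representation of functionals -/

section Integral

variable {𝕜 : Type*} [RCLike 𝕜]
variable {T : Type*} [MetricSpace T] [CompactSpace T] [MeasurableSpace T] [BorelSpace T]
variable {X : Type*} [NormedAddCommGroup X] [InnerProductSpace 𝕜 X]
  [NormedSpace ℝ X] [IsScalarTower ℝ 𝕜 X]

/-- Lipschitz functions determine a measure, hence so do continuous ones. -/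
theorem Phi_injective : Function.Injective (Phi 𝕜 T X) := by
  intro μ ν hμν
  refine sub_eq_zero.1 (eq_zero_of_sint_lip fun f _ => ?_)
  rw [← Phi_apply, map_sub, hμν, sub_self]
  simp

theorem enorm_sint_le (f : T → X) (μ : Cabv 𝕜 T X) :
    ‖sint f μ‖ₑ ≤ ∫⁻ t, ‖f t‖ₑ ∂μ.1.variation := by
  have h : ‖pairing 𝕜 X‖ₑ ≤ 1 := by
    rw [← ofReal_norm, ← ENNReal.ofReal_one]
    exact ENNReal.ofReal_le_ofReal (norm_pairing_le 𝕜)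
  exact VectorMeasure.enorm_integral_le_lintegral_enorm.trans (mul_le_of_le_one_left' h)

/-- The Monge–Kantorovich norm bounds the integral of every Lipschitz function, not only of those
in `BL₁(X)`. -/
theorem norm_sint_le_mul_mkNorm (μ : Cabv 𝕜 T X) {f : C(T, X)} (hf : IsLip f) :
    ‖sint f μ‖ ≤ (‖f‖ + lipConst f) * mkNorm μ := by
  have hL := lipConst_nonneg f
  rcases (add_nonneg (norm_nonneg f) hL).eq_or_lt with h0 | hpos
  · have hf0 : f = 0 := norm_le_zero_iff.1 (by linarith)
    rw [← Phi_apply, hf0, map_zero, norm_zero]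
    exact mul_nonneg (add_nonneg (norm_nonneg _) (lipConst_nonneg _)) (mkNorm_nonneg μ)
  set c : ℝ := ‖f‖ + lipConst f
  have hc : ‖((c⁻¹ : ℝ) : 𝕜)‖ = c⁻¹ := by
    rw [RCLike.norm_ofReal, abs_of_pos (inv_pos.2 hpos)]
  have hdist : ∀ s t, dist ((((c⁻¹ : ℝ) : 𝕜) • f) s) ((((c⁻¹ : ℝ) : 𝕜) • f) t)
      ≤ c⁻¹ * lipConst f * dist s t := fun s t => by
    simp only [ContinuousMap.smul_apply, dist_smul₀, hc, mul_assoc]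
    have := hf.dist_le_lipConst_mul s t
    gcongr
  have hC : 0 ≤ c⁻¹ * lipConst f := by positivity
  have hmem : ((c⁻¹ : ℝ) : 𝕜) • f ∈ BL1 T X := by
    refine ⟨⟨⟨_, hC⟩, LipschitzWith.of_dist_le_mul hdist⟩, ?_⟩
    calc ‖((c⁻¹ : ℝ) : 𝕜) • f‖ + lipConst (((c⁻¹ : ℝ) : 𝕜) • f : C(T, X))
        ≤ c⁻¹ * ‖f‖ + c⁻¹ * lipConst f := by
          rw [norm_smul, hc]
          gcongr
          exact lipConst_le_of_dist_le hC hdist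
      _ = 1 := by rw [← mul_add, inv_mul_cancel₀ hpos.ne']
  have h := le_mkNorm μ hmem
  have h1 : sint (((c⁻¹ : ℝ) : 𝕜) • f : C(T, X)) μ = ((c⁻¹ : ℝ) : 𝕜) * sint f μ := sint_smul μ _ f
  rwa [h1, norm_mul, hc, inv_mul_le_iff₀ hpos] at h

variable [CompleteSpace X]

/-- The `X`-valued measure with an integrable density, as an element of `cabv(T, X)`. -/
noncomputable def cabvWithDensity {lam : Measure T} {g : T → X} (hg : Integrable g lam) :
    Cabv 𝕜 T X :=
  ⟨lam.withDensityᵥ g, by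
    change (lam.withDensityᵥ g).variation univ < ∞
    rw [Measure.variation_withDensityᵥ hg]
    simpa using hasFiniteIntegral_iff_enorm.1 hg.2⟩

/-- Both sides are limits, under approximation of `f` by bounded simple functions, of expressions
that agree by `sint_simple`. -/
theorem sint_cabvWithDensity {lam : Measure T} {g : T → X} (hg : Integrable g lam) (f : C(T, X)) :
    sint f (cabvWithDensity (𝕜 := 𝕜) hg) = ∫ t, inner 𝕜 (g t) (f t) ∂lam := by
  have hf : StronglyMeasurable f := f.continuous.stronglyMeasurable
  let φ : ℕ → SimpleFunc T X := fun n => hf.approxBounded ‖f‖ n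
  have hb : ∀ n t, ‖φ n t‖ ≤ ‖f‖ := fun n t => hf.norm_approxBounded_le (norm_nonneg f) n t
  have hφ : ∀ t, Tendsto (fun n => φ n t) atTop (𝓝 (f t)) := fun t =>
    hf.tendsto_approxBounded_of_norm_le (f.norm_coe_le_norm t)
  have hlim : Tendsto (fun n => sint (φ n) (cabvWithDensity (𝕜 := 𝕜) hg)) atTop
      (𝓝 (sint f (cabvWithDensity hg))) :=
    VectorMeasure.tendsto_integral_filter_of_norm_le_const
      (Eventually.of_forall fun n => (φ n).aestronglyMeasurable)
      ⟨‖f‖, Eventually.of_forall fun n => Eventually.of_forall (hb n)⟩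
      (Eventually.of_forall hφ)
  have hlim' : Tendsto (fun n => ∫ t, inner 𝕜 (g t) (φ n t) ∂lam) atTop
      (𝓝 (∫ t, inner 𝕜 (g t) (f t) ∂lam)) := by
    refine tendsto_integral_of_dominated_convergence (fun t => ‖g t‖ * ‖f‖)
      (fun n => hg.aestronglyMeasurable.inner (φ n).aestronglyMeasurable)
      (hg.norm.mul_const _) (fun n => Eventually.of_forall fun t => ?_)
      (Eventually.of_forall fun t => tendsto_const_nhds.inner (hφ t))
    refine (norm_inner_le_norm _ _).trans ?_
    gcongr
    exact hb n t
  have hind : ∀ (x : X) {A : Set T}, MeasurableSet A →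
      Integrable (fun t => inner 𝕜 (g t) (A.indicator (fun _ => x) t)) lam ∧
      ∫ t, inner 𝕜 (g t) (A.indicator (fun _ => x) t) ∂lam = inner 𝕜 (∫ t in A, g t ∂lam) x := by
    intro x A hA
    have h1 : (fun t => inner 𝕜 (g t) (A.indicator (fun _ => x) t))
        = A.indicator fun t => inner 𝕜 (g t) x := by
      funext t
      by_cases ht : t ∈ A <;> simp [ht]
    rw [h1]
    refine ⟨(hg.inner_const x).indicator hA, ?_⟩
    rw [integral_indicator hA, ← inner_conj_symm, ← integral_inner hg.integrableOn,
      ← integral_conj]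
    simp_rw [inner_conj_symm]
  have heq : ∀ n, sint (φ n) (cabvWithDensity (𝕜 := 𝕜) hg) = ∫ t, inner 𝕜 (g t) (φ n t) ∂lam := by
    intro n
    rw [simpleFunc_eq_sum (φ n), sint_simple _ _ _ (fun x _ => (φ n).measurableSet_fiber x)]
    simp_rw [inner_sum]
    rw [integral_finsetSum _ fun x _ => (hind x ((φ n).measurableSet_fiber x)).1]
    refine Finset.sum_congr rfl fun x _ => ?_
    rw [(hind x ((φ n).measurableSet_fiber x)).2]
    congr 1
    exact withDensityᵥ_apply hg ((φ n).measurableSet_fiber x)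
  simp_rw [heq] at hlim
  exact tendsto_nhds_unique hlim hlim'

/-- A functional dominated by the `L¹` seminorm of a finite measure `lam` is an integral against
a measure in `cabv(T, X)`. It extends to the Hilbert space `L²(lam; X)`, where it is
the scalar product with some `g`, and the measure is `g lam`. -/
theorem exists_Phi_eq_of_enorm_le (y : StrongDual 𝕜 C(T, X)) (lam : Measure T)
    [IsFiniteMeasure lam] (hy : ∀ f : C(T, X), ‖y f‖ₑ ≤ ∫⁻ t, ‖f t‖ₑ ∂lam) :
    ∃ m : Cabv 𝕜 T X, Phi 𝕜 T X m = y := by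
  let e : C(T, X) →L[𝕜] Lp X 2 lam := ContinuousMap.toLp 2 lam 𝕜
  have hdense : DenseRange e := ContinuousMap.toLp_denseRange X lam 𝕜 (by simp)
  -- `‖f‖_{L¹} ≤ lam(T)^{1/2} ‖f‖_{L²}`, so `y` is bounded for the `L²` norm.
  have hbound : ∀ f, ‖y f‖ ≤ (lam univ ^ (1 / 2 : ℝ)).toReal * ‖e f‖ := by
    intro f
    have h1 : eLpNorm (e f) 2 lam = eLpNorm f 2 lam :=
      eLpNorm_congr_ae (ContinuousMap.coeFn_toLp lam f)
    have h2 : ‖y f‖ₑ ≤ lam univ ^ (1 / 2 : ℝ) * ‖e f‖ₑ := by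
      refine (hy f).trans ?_
      rw [Lp.enorm_def, h1, mul_comm, ← eLpNorm_one_eq_lintegral_enorm]
      convert! eLpNorm_le_eLpNorm_mul_rpow_measure_univ (p := 1) (q := 2) (μ := lam) (by norm_num)
        f.continuous.aestronglyMeasurable using 3
      norm_num
    have h3 := ENNReal.toReal_mono (ENNReal.mul_ne_top (by finiteness) enorm_ne_top) h2
    simpa using h3
  let Y : StrongDual 𝕜 (Lp X 2 lam) := (y : C(T, X) →ₗ[𝕜] 𝕜).extendOfNorm (e : C(T, X) →ₗ[𝕜] _)
  have hY : ∀ f, Y (e f) = y f := fun f => LinearMap.extendOfNorm_eq hdense ⟨_, hbound⟩ f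
  let g : Lp X 2 lam := (InnerProductSpace.toDual 𝕜 _).symm Y
  have hg : Integrable g lam := (Lp.memLp g).integrable (by norm_num)
  refine ⟨cabvWithDensity hg, ContinuousLinearMap.ext fun f => ?_⟩
  rw [Phi_apply, sint_cabvWithDensity, ← hY, ← InnerProductSpace.toDual_symm_apply, L2.inner_def]
  refine integral_congr_ae ?_
  filter_upwards [ContinuousMap.coeFn_toLp (p := 2) (𝕜 := 𝕜) lam f] with t ht
  rw [← ht]

end Integral

/-! ### The operators `H_C` and `ℋ` -/

section Operators

variable {𝕜 : Type*} [RCLike 𝕜]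
variable {T : Type*} [MetricSpace T] [CompactSpace T] [MeasurableSpace T] [BorelSpace T]
variable {X : Type*} [NormedAddCommGroup X] [InnerProductSpace 𝕜 X]
  [NormedSpace ℝ X] [IsScalarTower ℝ 𝕜 X] [MeasurableSpace X] [BorelSpace X]
variable {Θ : Type*} [MeasurableSpace Θ] {W : Measure Θ} {R : Θ → X →L[𝕜] X} {ω : Θ → T → T}

namespace Admissible

/-- Although `r_θ` is a supremum over uncountably many pairs, it is measurable: by continuity of
`ω_θ`, the pairs from a countable dense set suffice. -/
theorem measurable_lipConst (h : Admissible W R ω) : Measurable fun θ => lipConst (ω θ) := by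
  cases isEmpty_or_nonempty T
  · have h0 : ∀ θ, lipConst (ω θ) = 0 := fun θ =>
      le_antisymm (lipConst_le_of_dist_le le_rfl fun x => isEmptyElim x) (lipConst_nonneg _)
    simp [h0]
  · have hd := TopologicalSpace.denseRange_denseSeq T
    simp_rw [fun θ => (h.isLip_omega θ).lipConst_eq_iSup hd]
    have hm : ∀ t, Measurable fun θ => ω θ t := fun t =>
      h.measurable_omega.comp measurable_prodMk_left
    exact Measurable.iSup fun p => ((hm _).dist (hm _)).div_const _

/-- Finiteness of the integral in `Admissible` is integrability, because `θ ↦ r_θ` is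
measurable; so the Bochner integral that bounds the operator norm is not a junk value. -/
theorem integrable_norm_mul_one_add (h : Admissible W R ω) :
    Integrable (fun θ => ‖R θ‖ * (1 + lipConst (ω θ))) W := by
  refine ⟨(h.measurable_norm.mul (h.measurable_lipConst.const_add 1)).aestronglyMeasurable, ?_⟩
  refine lt_of_eq_of_lt (lintegral_congr fun θ => ?_) h.lintegral_lt_top
  have := lipConst_nonneg (ω θ)
  rw [Real.enorm_of_nonneg (by positivity)]

theorem integrable_norm_mul_lipConst (h : Admissible W R ω) :
    Integrable (fun θ => ‖R θ‖ * lipConst (ω θ)) W := by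
  refine (h.integrable_norm_mul_one_add.sub h.integrable_norm).congr
    (Eventually.of_forall fun θ => ?_)
  simp only [Pi.sub_apply]
  ring

theorem dist_HC_le (h : Admissible W R ω) {f : C(T, X)} (hf : IsLip f) (s t : T) :
    dist (HC h f s) (HC h f t)
      ≤ (∫ θ, ‖R θ‖ * lipConst (ω θ) ∂W) * lipConst f * dist s t := by
  rw [dist_eq_norm, HC_apply, HC_apply,
    ← integral_sub (h.integrable_apply f s) (h.integrable_apply f t), mul_assoc,
    ← integral_mul_const]
  refine norm_integral_le_of_norm_le (h.integrable_norm_mul_lipConst.mul_const _)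
    (Eventually.of_forall fun θ => ?_)
  have h1 := hf.dist_le_lipConst_mul (ω θ s) (ω θ t)
  have h2 := (h.isLip_omega θ).dist_le_lipConst_mul s t
  have h3 := lipConst_nonneg f
  rw [← map_sub]
  calc ‖R θ (f (ω θ s) - f (ω θ t))‖ ≤ ‖R θ‖ * ‖f (ω θ s) - f (ω θ t)‖ := (R θ).le_opNorm _
    _ ≤ ‖R θ‖ * (lipConst f * (lipConst (ω θ) * dist s t)) := by
      rw [← dist_eq_norm]
      gcongr
      exact h1.trans (by gcongr)
    _ = _ := by ring

theorem isLip_HC (h : Admissible W R ω) {f : C(T, X)} (hf : IsLip f) : IsLip (HC h f) := by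
  have h0 : 0 ≤ (∫ θ, ‖R θ‖ * lipConst (ω θ) ∂W) * lipConst f :=
    mul_nonneg (integral_nonneg fun θ => mul_nonneg (norm_nonneg _) (lipConst_nonneg _))
      (lipConst_nonneg _)
  exact ⟨⟨_, h0⟩, LipschitzWith.of_dist_le_mul (h.dist_HC_le hf)⟩

/-- `H_C` maps `BL₁(X)` into its multiple by `∫ ‖R_θ‖ (1 + r_θ) dW(θ)`. -/
theorem norm_HC_add_lipConst_le (h : Admissible W R ω) {f : C(T, X)} (hf : f ∈ BL1 T X) :
    ‖HC h f‖ + lipConst (HC h f) ≤ ∫ θ, ‖R θ‖ * (1 + lipConst (ω θ)) ∂W := by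
  have hL := lipConst_nonneg f
  have hf1 : ‖f‖ ≤ 1 := by linarith [hf.2]
  have hf2 : lipConst f ≤ 1 := by linarith [hf.2, norm_nonneg f]
  have h0 : 0 ≤ ∫ θ, ‖R θ‖ ∂W := integral_nonneg fun θ => norm_nonneg _
  have h0' : 0 ≤ ∫ θ, ‖R θ‖ * lipConst (ω θ) ∂W :=
    integral_nonneg fun θ => mul_nonneg (norm_nonneg _) (lipConst_nonneg _)
  have hn : ‖HC h f‖ ≤ ∫ θ, ‖R θ‖ ∂W := by
    refine (ContinuousMap.norm_le _ h0).2 fun t => ?_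
    refine norm_integral_le_of_norm_le h.integrable_norm (Eventually.of_forall fun θ => ?_)
    exact (norm_apply_le f t θ).trans (mul_le_of_le_one_right (norm_nonneg _) hf1)
  have hl : lipConst (HC h f) ≤ ∫ θ, ‖R θ‖ * lipConst (ω θ) ∂W :=
    (lipConst_le_of_dist_le (mul_nonneg h0' hL) (h.dist_HC_le hf.1)).trans
      (mul_le_of_le_one_right h0' hf2)
  calc ‖HC h f‖ + lipConst (HC h f)
      ≤ ∫ θ, ‖R θ‖ ∂W + ∫ θ, ‖R θ‖ * lipConst (ω θ) ∂W := add_le_add hn hl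
    _ = _ := by
      rw [← integral_add h.integrable_norm h.integrable_norm_mul_lipConst]
      simp_rw [mul_add, mul_one]

/-- The functional `f ↦ ∫ H_C(f) dν` is dominated by the `L¹` seminorm of the image
of `|ν| ⊗ ‖R_θ‖ dW(θ)` under `(t, θ) ↦ ω_θ(t)`, hence comes from a measure in `cabv(T, X)`. -/
theorem exists_Phi_eq_HCadj [CompleteSpace X] (h : Admissible W R ω) (ν : Cabv 𝕜 T X) :
    ∃ m : Cabv 𝕜 T X, Phi 𝕜 T X m = HCadj h (Phi 𝕜 T X ν) := by
  have hmR : Measurable fun θ => ‖R θ‖ₑ := by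
    simpa using h.measurable_norm.enorm
  let V : Measure Θ := W.withDensity fun θ => ‖R θ‖ₑ
  have : IsFiniteMeasure V := ⟨by
    rw [withDensity_apply _ MeasurableSet.univ, Measure.restrict_univ]
    simpa using hasFiniteIntegral_iff_enorm.1 h.integrable_norm.2⟩
  refine exists_Phi_eq_of_enorm_le _
    ((ν.1.variation.prod V).map fun p : T × Θ => ω p.2 p.1) fun f => ?_
  have hmf : Measurable fun t => ‖f t‖ₑ := f.continuous.enorm.measurable
  have hmp : Measurable fun p : T × Θ => ‖f (ω p.2 p.1)‖ₑ := hmf.comp h.measurable_omega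
  rw [lintegral_map hmf h.measurable_omega, lintegral_prod _ hmp.aemeasurable]
  refine (enorm_sint_le (HC h f) ν).trans (lintegral_mono fun t => ?_)
  have hmt : Measurable fun θ => ‖f (ω θ t)‖ₑ := hmp.comp measurable_prodMk_left
  rw [lintegral_withDensity_eq_lintegral_mul _ hmR hmt]
  refine (enorm_integral_le_lintegral_enorm _).trans (lintegral_mono fun θ => ?_)
  exact (R θ).le_opENorm _

end Admissible

theorem Phi_opH [CompleteSpace X] (h : Admissible W R ω) (ν : Cabv 𝕜 T X) :
    Phi 𝕜 T X (opH h ν) = HCadj h (Phi 𝕜 T X ν) :=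
  Function.invFun_eq (h.exists_Phi_eq_HCadj ν)

theorem sint_opH [CompleteSpace X] (h : Admissible W R ω) (ν : Cabv 𝕜 T X) (f : C(T, X)) :
    sint f (opH h ν) = sint (HC h f) ν :=
  DFunLike.congr_fun (Phi_opH h ν) f

/-- `opH` as a linear map: the antilinearity of `Φ` and that of its inverse cancel. -/
noncomputable def opHLinear [CompleteSpace X] (h : Admissible W R ω) :
    Cabv 𝕜 T X →ₗ[𝕜] Cabv 𝕜 T X where
  toFun := opH h
  map_add' μ ν := Phi_injective <| by
    simp only [Phi_opH, map_add]
    rfl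
  map_smul' c ν := Phi_injective <| by
    rw [RingHom.id_apply, Phi_opH, map_smulₛₗ, map_smulₛₗ, Phi_opH]
    rfl

theorem mkNorm_opH_le [CompleteSpace X] (h : Admissible W R ω) (ν : Cabv 𝕜 T X) :
    mkNorm (opH h ν) ≤ (∫ θ, ‖R θ‖ * (1 + lipConst (ω θ)) ∂W) * mkNorm ν :=
  mkNorm_le _ fun f hf => by
    rw [sint_opH]
    exact (norm_sint_le_mul_mkNorm ν (h.isLip_HC hf.1)).trans
      (mul_le_mul_of_nonneg_right (h.norm_HC_add_lipConst_le hf) (mkNorm_nonneg ν))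

end Operators

end MKOp

open MKOp
theorem theorem4p5
    {𝕜 : Type*} [RCLike 𝕜]
    {T : Type*} [MetricSpace T] [CompactSpace T] [Nontrivial T]
    [MeasurableSpace T] [BorelSpace T]
    {X : Type*} [NormedAddCommGroup X] [InnerProductSpace 𝕜 X] [CompleteSpace X] [Nontrivial X]
    [NormedSpace ℝ X] [IsScalarTower ℝ 𝕜 X] [MeasurableSpace X] [BorelSpace X]
    {Θ : Type*} [MeasurableSpace Θ] (W : Measure Θ)
    (R : Θ → X →L[𝕜] X) (ω : Θ → T → T) (h : Admissible W R ω) :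
    (∀ ν m : Cabv 𝕜 T X, m = opH h ν ↔ Phi 𝕜 T X m = HCadj h (Phi 𝕜 T X ν)) ∧
    ∃ L : Cabv 𝕜 T X →L[𝕜] Cabv 𝕜 T X,
      (∀ ν, L ν = opH h ν) ∧ ‖L‖ ≤ ∫ θ, ‖R θ‖ * (1 + lipConst (ω θ)) ∂W := by
  refine ⟨fun ν m => ?_, (opHLinear h).mkContinuous _ (mkNorm_opH_le h), fun ν => rfl, ?_⟩
  · rw [← Phi_opH]
    exact Phi_injective.eq_iff.symm
  · refine LinearMap.mkContinuous_norm_le _ (integral_nonneg fun θ => ?_) _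
    have := lipConst_nonneg (ω θ)
    positivity
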